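/- Let $E=\mathbb C/\Lambda$ and $E'=\mathbb C/\Lambda'$ be one-dimensional complex tori, let $A=E\times E'$, and let $C_1,\dots,C_4\subset A$ be four one-dimensional complex tori in $A$ (images of holomorphic embeddings $\mathbb C/M_j\hookrightarrow A$ with $M_j\subset\mathbb C$ a lattice) such that $C_j\cdot C_k\neq 0$ whenever $j\neq k$, where $C\cdot D$ denotes the intersection number. Then for every integer $e>1$ (in particular for every prime $e=p$) the following hold. (1) There is an $e$-fold étale cover $\pi\colon A'\to A$ (a connected complex surface $A'$ with a holomorphic, locally biholomorphic covering map $\pi$, all of whose fibres have $e$ points) such that $\pi^{-1}(C_j)$ is connected for $j=1,\dots,4$. (2) For every such $e$-fold étale cover $\pi$ with all $\pi^{-1}(C_j)$ connected, $\pi^{-1}(C_j)\cdot\pi^{-1}(C_k)=e\,(C_j\cdot C_k)$ for all $j,k$. -/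

import Mathlib

open scoped Manifold ContDiff Topology

noncomputable section

/-! ### Complex tori -/

/-- The quotient `V / Λ` of a complex vector space by a subgroup `Λ`. It is a complex torus when
`Λ` is a lattice, that is, discrete and spanning `V` over the reals. -/
abbrev ComplexTorus {V : Type*} [NormedAddCommGroup V] [NormedSpace ℂ V] (Λ : Submodule ℤ V) :
    Type _ :=
  V ⧸ Λ.toAddSubgroup

namespace ComplexTorus

variable {V : Type*} [NormedAddCommGroup V] [NormedSpace ℂ V]

/-- The quotient map `V → V / Λ`. -/
def mk (Λ : Submodule ℤ V) (v : V) : ComplexTorus Λ :=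
  QuotientAddGroup.mk v

theorem mk_surjective (Λ : Submodule ℤ V) : Function.Surjective (mk Λ) :=
  QuotientAddGroup.mk_surjective

theorem mk_eq_mk (Λ : Submodule ℤ V) {v w : V} : mk Λ v = mk Λ w ↔ w - v ∈ Λ := by
  unfold mk
  rw [QuotientAddGroup.eq, neg_add_eq_sub]
  exact Iff.rfl

theorem isCoveringMap_mk (Λ : Submodule ℤ V) [h : DiscreteTopology Λ] :
    IsCoveringMap (mk Λ) :=
  (AddSubgroup.isAddQuotientCoveringMap_of_comm Λ.toAddSubgroup ⟨h⟩).isCoveringMap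

theorem isLocalHomeomorph_mk (Λ : Submodule ℤ V) [DiscreteTopology Λ] :
    IsLocalHomeomorph (mk Λ) :=
  (isCoveringMap_mk Λ).isLocalHomeomorph

/-- The charts of `V / Λ` are the local inverses of the quotient map `V → V / Λ`. -/
instance instChartedSpace (Λ : Submodule ℤ V) [DiscreteTopology Λ] :
    ChartedSpace V (ComplexTorus Λ) :=
  (isLocalHomeomorph_mk Λ).chartedSpace (mk_surjective Λ)

theorem mk_chart (Λ : Submodule ℤ V) [DiscreteTopology Λ]
    {c : OpenPartialHomeomorph (ComplexTorus Λ) V} (hc : c ∈ atlas V (ComplexTorus Λ))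
    {y : ComplexTorus Λ} (hy : y ∈ c.source) : mk Λ (c y) = y := by
  obtain ⟨q, rfl⟩ := hc
  simp only [chartAt_self_eq, OpenPartialHomeomorph.trans_refl] at hy ⊢
  exact (isLocalHomeomorph_mk Λ).apply_localInverseAt_of_mem hy

/-- Coordinate changes are locally translations, so `V / Λ` is a complex manifold. -/
instance instIsManifold (Λ : Submodule ℤ V) [DiscreteTopology Λ] :
    IsManifold 𝓘(ℂ, V) ω (ComplexTorus Λ) := by
  refine isManifold_of_contDiffOn _ _ _ fun c d hc hd => ?_
  simp only [modelWithCornersSelf_coe, modelWithCornersSelf_coe_symm, Function.comp_id,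
    Function.id_comp, Set.preimage_id, Set.range_id, Set.inter_univ]
  set s := (c.symm.trans d).source with hs
  have hso : IsOpen s := (c.symm.trans d).open_source
  have hmem : ∀ z ∈ s, (c.symm.trans d) z - z ∈ Λ := by
    intro z hz
    rw [hs, OpenPartialHomeomorph.trans_source] at hz
    have h1 : mk Λ (d (c.symm z)) = c.symm z := mk_chart Λ hd hz.2
    have h2 : mk Λ (c (c.symm z)) = c.symm z := mk_chart Λ hc (c.map_target hz.1)
    rw [c.right_inv hz.1] at h2
    exact (mk_eq_mk Λ).1 (h2.trans h1.symm)
  have hcont : ContinuousOn (fun z => (c.symm.trans d) z - z) s :=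
    (c.symm.trans d).continuousOn.sub continuousOn_id
  intro z hz
  obtain ⟨U, hU, hUΛ⟩ : ∃ U ∈ 𝓝 ((c.symm.trans d) z - z),
      ∀ w ∈ U, w ∈ Λ → w = (c.symm.trans d) z - z := by
    have := (isOpen_discrete ({⟨_, hmem z hz⟩} : Set Λ)).mem_nhds rfl
    obtain ⟨U, hU, hsub⟩ := mem_nhds_subtype _ _ _ |>.1 this
    exact ⟨U, hU, fun w hw hwΛ => congrArg Subtype.val (hsub (a := ⟨w, hwΛ⟩) hw)⟩
  have hev : ∀ᶠ w in 𝓝 z, (c.symm.trans d) w = w + ((c.symm.trans d) z - z) := by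
    filter_upwards [hso.mem_nhds hz, (hcont.continuousAt (hso.mem_nhds hz)).preimage_mem_nhds hU]
      with w hw hwU
    rw [← hUΛ _ hwU (hmem w hw)]
    exact (add_sub_cancel _ _).symm
  have : ContDiffAt ℂ ω (c.symm.trans d) z :=
    (contDiffAt_id.add contDiffAt_const).congr_of_eventuallyEq hev
  exact this.contDiffWithinAt

end ComplexTorus

/-! ### Curves in complex surfaces, and their intersection numbers

`X` is a complex manifold, in the applications below of dimension two. -/

section Curves

variable {E : Type*} [NormedAddCommGroup E] [NormedSpace ℂ E]
  {H : Type*} [TopologicalSpace H] (I : ModelWithCorners ℂ E H)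
  {X : Type*} [TopologicalSpace X] [ChartedSpace H X]

/-- `C` is a torus in the complex manifold `X`: the image of a holomorphic embedding into `X` of a
one-dimensional complex torus `ℂ / M`. -/
def IsTorusIn (C : Set X) : Prop :=
  ∃ (M : Submodule ℤ ℂ) (_ : DiscreteTopology M) (_ : IsZLattice ℝ M) (f : ComplexTorus M → X),
    Manifold.IsSmoothEmbedding 𝓘(ℂ, ℂ) I ω f ∧ Set.range f = C

/-- `g` is a local holomorphic parametrization, centred at `x`, of the smooth curve `C`: it is
holomorphic near `0` with nonzero derivative there, and it maps the neighbourhoods of `0` onto the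
neighbourhoods of `x` in `C`. -/
structure IsLocalParametrization (C : Set X) (x : X) (g : ℂ → X) : Prop where
  map_zero : g 0 = x
  holomorphic : ContMDiffAt 𝓘(ℂ, ℂ) I ω g 0
  immersive : Function.Injective (mfderiv 𝓘(ℂ, ℂ) I g 0)
  map_nhds : Filter.map g (𝓝 0) = 𝓝[C] x

/-- `h` is a local equation at `x` of the smooth curve `D`: it is holomorphic near `x` with nonzero
differential at `x`, and near `x` the curve `D` is the zero set of `h`. -/
structure IsLocalEquation (D : Set X) (x : X) (h : X → ℂ) : Prop where
  holomorphic : ContMDiffAt I 𝓘(ℂ, ℂ) ω h x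
  submersive : Function.Surjective (mfderiv I 𝓘(ℂ, ℂ) h x)
  eventually_mem_iff : ∀ᶠ y in 𝓝 x, y ∈ D ↔ h y = 0

/-- The local intersection multiplicity `i_x(C, D)` of two smooth curves in a complex surface at a
common point `x`: the order of vanishing at `x` of a local equation of `D` along `C`. All choices
of a parametrization of `C` and of a local equation of `D` give the same order, so the infimum is
over equal values. The multiplicity is `⊤` exactly when `C` and `D` coincide near `x`. -/
def intersectionMultiplicity (C D : Set X) (x : X) : ℕ∞ :=
  ⨅ (g : ℂ → X) (_ : IsLocalParametrization I C x g)
    (h : X → ℂ) (_ : IsLocalEquation I D x h), analyticOrderAt (h ∘ g) 0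

/-- The intersection number `C · D` of two compact smooth curves in a complex surface: the sum of
the local intersection multiplicities over the common points.
For connected `C` and `D`, either there are finitely many common points, each of finite
multiplicity, or `C = D`. In the latter case all multiplicities are `⊤`, which count as `0`;
for a torus `C` in a complex surface with trivial canonical bundle, such as a two-dimensional
complex torus, this is the self-intersection number, which is `0` by the adjunction formula. -/
def intersectionNumber (C D : Set X) : ℕ :=
  ∑ᶠ x ∈ C ∩ D, (intersectionMultiplicity I C D x).toNat

end Curves

/-! ### Étale covers -/

/-- `π : Y → X` is an `e`-fold étale cover of complex manifolds: `Y` is connected and `π` is a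
covering map and a local biholomorphism all of whose fibres have `e` points (with `e ≠ 0`). -/
structure IsEtaleCover {E : Type*} [NormedAddCommGroup E] [NormedSpace ℂ E]
    {E' : Type*} [NormedAddCommGroup E'] [NormedSpace ℂ E']
    {H : Type*} [TopologicalSpace H] (I : ModelWithCorners ℂ E H)
    {H' : Type*} [TopologicalSpace H'] (I' : ModelWithCorners ℂ E' H')
    {Y : Type*} [TopologicalSpace Y] [ChartedSpace H Y]
    {X : Type*} [TopologicalSpace X] [ChartedSpace H' X]
    (e : ℕ) (π : Y → X) : Prop where
  connected : ConnectedSpace Y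
  isCoveringMap : IsCoveringMap π
  isLocalDiffeomorph : IsLocalDiffeomorph I I' ω π
  degree_ne_zero : e ≠ 0
  card_fiber : ∀ x : X, Set.encard (π ⁻¹' {x}) = e

end

/-! By Liouville's theorem, holomorphic maps of one-dimensional tori are affine, so each `C j` is
the image of a line in ℂ² (`IsTorusIn.exists_affine`). The points of N = Λ × Λ' on the parallel line
through 0 form a saturated subgroup L_j of rank 2 in rank 4. If χ : N → ℤ takes a value ≡ 1 mod e on
L_j, put Γ = χ⁻¹(eℤ). Then ℂ²/Γ → A is étale of degree e, and L_j meets every class of N/Γ, so all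
N-translates of the line have one image in ℂ²/Γ: the preimage of `C j` is connected.

One χ must serve all four L_j (`Submodule.exists_functional_modEq_one`). Modulo a prime p, each L_j,
being a direct summand, is killed by p² of the p⁴ functionals, and 4(p² − 1) < p⁴ − 1, so some
functional is nonzero on every L_j. The Chinese remainder theorem glues such choices for all p ∣ e;
then χ(L_j) = dℤ with d prime to e.

The formula in (2) holds because local multiplicities are invariant under local biholomorphisms and
every point has e preimages. -/

/-! ### Functionals on a lattice of rank four -/

theorem Module.card_linearMap_zmod {N : Type*} [AddCommGroup N] [Module.Free ℤ N]
    [Module.Finite ℤ N] (p : ℕ) :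
    Nat.card (N →ₗ[ℤ] ZMod p) = p ^ Module.finrank ℤ N := by
  let b := Module.Free.chooseBasis ℤ N
  rw [Nat.card_congr (b.constr ℤ (M' := ZMod p)).symm.toEquiv, Nat.card_fun, Nat.card_zmod,
    Module.finrank_eq_card_chooseBasisIndex, Nat.card_eq_fintype_card]

/-- Linear maps extend from a saturated submodule of a finitely generated free group. -/
theorem Submodule.exists_extend_of_saturated {N P : Type*} [AddCommGroup N] [Module.Free ℤ N]
    [Module.Finite ℤ N] [AddCommGroup P] (L : Submodule ℤ N)
    (hL : ∀ (n : ℤ) (x : N), n ≠ 0 → n • x ∈ L → x ∈ L) (g : L →ₗ[ℤ] P) :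
    ∃ f : N →ₗ[ℤ] P, f ∘ₗ L.subtype = g := by
  -- Saturation makes the quotient torsion-free, hence free, so it splits; x ↦ x − s(x̄) is then a
  -- projection onto `L`.
  have : Module.IsTorsionFree ℤ (N ⧸ L) := by
    refine Module.IsTorsionFree.of_smul_eq_zero fun n x hx => ?_
    obtain ⟨x, rfl⟩ := L.mkQ_surjective x
    by_cases hn : n = 0
    · exact Or.inl hn
    · right
      rw [← map_smul] at hx
      simp only [mkQ_apply, Quotient.mk_eq_zero] at hx ⊢
      exact hL n x hn hx
  have : Module.Free ℤ (N ⧸ L) := Module.free_of_finite_type_torsion_free'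
  obtain ⟨s, hs⟩ := Module.projective_lifting_property L.mkQ LinearMap.id L.mkQ_surjective
  have hr : ∀ x, x - s (L.mkQ x) ∈ L := fun x => by
    rw [← Quotient.mk_eq_zero L, ← mkQ_apply, map_sub, sub_eq_zero]
    exact (LinearMap.congr_fun hs (L.mkQ x)).symm
  refine ⟨g ∘ₗ (LinearMap.id - s ∘ₗ L.mkQ).codRestrict L hr, LinearMap.ext fun x => ?_⟩
  simp only [LinearMap.comp_apply]
  congr 1
  ext
  have : L.mkQ (x : N) = 0 := by simp
  simp [LinearMap.codRestrict, -mkQ_apply, this]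

/-- Restriction to `L` is onto by saturation, so its kernel has p⁴ / p² elements. -/
theorem Submodule.card_annihilator_zmod {N : Type*} [AddCommGroup N] [Module.Free ℤ N]
    [Module.Finite ℤ N] (hN : Module.finrank ℤ N = 4) (L : Submodule ℤ N)
    (hr : Module.finrank ℤ L = 2)
    (hL : ∀ (n : ℤ) (x : N), n ≠ 0 → n • x ∈ L → x ∈ L) (p : ℕ) (hp : 0 < p) :
    Nat.card {f : N →ₗ[ℤ] ZMod p // ∀ x ∈ L, f x = 0} = p ^ 2 := by
  have : NeZero p := ⟨hp.ne'⟩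
  let r : (N →ₗ[ℤ] ZMod p) →+ (L →ₗ[ℤ] ZMod p) :=
    { toFun := fun f => f ∘ₗ L.subtype, map_zero' := rfl, map_add' := fun _ _ => rfl }
  have hrs : Function.Surjective r := fun g => L.exists_extend_of_saturated hL g
  have h1 := r.ker.card_mul_index
  rw [AddSubgroup.index_ker, AddMonoidHom.range_eq_top.2 hrs, AddSubgroup.card_top,
    Module.card_linearMap_zmod, Module.card_linearMap_zmod, hN, hr] at h1
  have h2 : Nat.card {f : N →ₗ[ℤ] ZMod p // ∀ x ∈ L, f x = 0} = Nat.card r.ker := by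
    refine Nat.card_congr (Equiv.subtypeEquivRight fun f => ?_)
    rw [AddMonoidHom.mem_ker]
    exact ⟨fun h => LinearMap.ext fun x => h x x.2, fun h x hx => LinearMap.congr_fun h ⟨x, hx⟩⟩
  rw [h2]
  have h3 : 0 < p ^ 2 := by positivity
  exact Nat.eq_of_mul_eq_mul_right h3 (by rw [h1]; ring)

/-- Four saturated subgroups of rank two of a free group of rank four: for every prime `p` some
functional modulo `p` is nonzero on all of them. -/
theorem Submodule.exists_functional_zmod {N : Type*} [AddCommGroup N] [Module.Free ℤ N]
    [Module.Finite ℤ N] (hN : Module.finrank ℤ N = 4) (L : Fin 4 → Submodule ℤ N)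
    (hr : ∀ j, Module.finrank ℤ (L j) = 2)
    (hL : ∀ j, ∀ (n : ℤ) (x : N), n ≠ 0 → n • x ∈ L j → x ∈ L j) (p : ℕ) (hp : 2 ≤ p) :
    ∃ f : N →ₗ[ℤ] ZMod p, ∀ j, ∃ x ∈ L j, f x ≠ 0 := by
  classical
  have : NeZero p := ⟨by omega⟩
  by_contra! h
  have hcard := Module.card_linearMap_zmod (N := N) p
  have : Finite (N →ₗ[ℤ] ZMod p) := Nat.finite_of_card_ne_zero (by
    rw [hcard]; positivity)
  have := Fintype.ofFinite (N →ₗ[ℤ] ZMod p)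
  let K : Fin 4 → Finset (N →ₗ[ℤ] ZMod p) := fun j => {f | ∀ x ∈ L j, f x = 0}
  have hK : ∀ j, (K j).card = p ^ 2 := fun j => by
    rw [← (L j).card_annihilator_zmod hN (hr j) (hL j) p (by omega), Nat.card_eq_fintype_card,
      Fintype.card_subtype]
  have h0 : ∀ j, (0 : N →ₗ[ℤ] ZMod p) ∈ K j := fun j => by simp [K]
  -- Zero lies in all four annihilators and has to be discarded: at p = 2 the cruder bound p⁴ ≤ 4p²
  -- is no contradiction.
  have hsub : (Finset.univ : Finset (N →ₗ[ℤ] ZMod p)).erase 0 ⊆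
      Finset.univ.biUnion fun j => (K j).erase 0 := by
    intro f hf
    obtain ⟨j, hj⟩ := h f
    simp only [Finset.mem_biUnion, Finset.mem_erase]
    exact ⟨j, Finset.mem_univ _, (Finset.mem_erase.1 hf).1, by simpa [K] using hj⟩
  have hle := (Finset.card_le_card hsub).trans Finset.card_biUnion_le
  simp only [Finset.card_erase_of_mem (h0 _), hK, Finset.card_erase_of_mem (Finset.mem_univ _),
    Finset.card_univ, Finset.sum_const, Fintype.card_fin, smul_eq_mul,
    ← Nat.card_eq_fintype_card (α := N →ₗ[ℤ] ZMod p), hcard, hN] at hle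
  have h4 : 4 ≤ p ^ 2 := by nlinarith
  obtain ⟨k, hk⟩ : ∃ k, p ^ 2 = k + 4 := ⟨p ^ 2 - 4, by omega⟩
  have h5 : p ^ 4 = (k + 4) * (k + 4) := by rw [← hk]; ring
  rw [h5, hk] at hle
  have : (k + 4) * (k + 4) ≤ 4 * (k + 3) + 1 := by
    have : k + 4 - 1 = k + 3 := rfl
    omega
  nlinarith

/-- The chinese remainder theorem for functionals on a finitely generated free group. -/
theorem Module.exists_functional_of_zmod {N : Type*} [AddCommGroup N] [Module.Free ℤ N]
    [Module.Finite ℤ N] (s : Finset ℕ) (hs : ∀ p ∈ s, p.Prime)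
    (f : (p : ℕ) → N →ₗ[ℤ] ZMod p) :
    ∃ χ : N →ₗ[ℤ] ℤ, ∀ p ∈ s, ∀ x, ((χ x : ℤ) : ZMod p) = f p x := by
  classical
  let b := Module.Free.chooseBasis ℤ N
  have hcrt : ∀ i, ∃ c : ℕ, ∀ p ∈ s, (c : ZMod p) = f p (b i) := by
    intro i
    obtain ⟨c, hc⟩ := Nat.chineseRemainderOfFinset (fun p => (f p (b i)).val) id s
      (fun p hp => (hs p hp).ne_zero)
      (fun p hp q hq hpq => (Nat.coprime_primes (hs p hp) (hs q hq)).2 hpq)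
    refine ⟨c, fun p hp => ?_⟩
    have : NeZero p := ⟨(hs p hp).ne_zero⟩
    rw [(ZMod.natCast_eq_natCast_iff _ _ _).2 (hc p hp), ZMod.natCast_zmod_val]
  choose c hc using hcrt
  refine ⟨b.constr ℤ fun i => (c i : ℤ), fun p hp x => ?_⟩
  have : (Int.castAddHom (ZMod p)).toIntLinearMap ∘ₗ (b.constr ℤ fun i => (c i : ℤ)) = f p := by
    refine b.ext fun i => ?_
    simp [hc i p hp]
  exact LinearMap.congr_fun this x

/-- For four saturated subgroups of rank two of a free group of rank four and every `e`, some
integral functional takes on each of them a value congruent to one modulo `e`. -/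
theorem Submodule.exists_functional_modEq_one {N : Type*} [AddCommGroup N] [Module.Free ℤ N]
    [Module.Finite ℤ N] (hN : Module.finrank ℤ N = 4) (L : Fin 4 → Submodule ℤ N)
    (hr : ∀ j, Module.finrank ℤ (L j) = 2)
    (hL : ∀ j, ∀ (n : ℤ) (x : N), n ≠ 0 → n • x ∈ L j → x ∈ L j) (e : ℕ) (he : e ≠ 0) :
    ∃ χ : N →ₗ[ℤ] ℤ, ∀ j, ∃ x ∈ L j, (e : ℤ) ∣ χ x - 1 := by
  have h := fun p : ℕ => fun hp : 2 ≤ p => Submodule.exists_functional_zmod hN L hr hL p hp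
  -- The default 0 is harmless, since only prime divisors of `e` are used.
  let f : (p : ℕ) → N →ₗ[ℤ] ZMod p := fun p => if hp : 2 ≤ p then (h p hp).choose else 0
  obtain ⟨χ, hχ⟩ := Module.exists_functional_of_zmod e.primeFactors
    (fun p hp => Nat.prime_of_mem_primeFactors hp) f
  refine ⟨χ, fun j => ?_⟩
  obtain ⟨d, hd⟩ := (IsPrincipalIdealRing.principal ((L j).map χ)).principal
  -- A prime dividing both would make χ vanish modulo p on `L j`.
  have hcop : IsCoprime d (e : ℤ) := by
    rw [Int.isCoprime_iff_gcd_eq_one]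
    by_contra hne
    obtain ⟨p, hp, hpd⟩ := Nat.exists_prime_and_dvd hne
    have hpd' : (p : ℤ) ∣ d := (Int.natCast_dvd_natCast.2 hpd).trans (Int.gcd_dvd_left _ _)
    have hpe : p ∣ e := Int.natCast_dvd_natCast.1
      ((Int.natCast_dvd_natCast.2 hpd).trans (Int.gcd_dvd_right _ _))
    obtain ⟨x, hx, hfx⟩ := (h p hp.two_le).choose_spec j
    have hmem : χ x ∈ (L j).map χ := Submodule.mem_map_of_mem hx
    rw [hd, Submodule.mem_span_singleton] at hmem
    obtain ⟨k, hk⟩ := hmem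
    have h1 := hχ p (Nat.mem_primeFactors.2 ⟨hp, hpe, he⟩) x
    simp only [f, hp.two_le, dif_pos] at h1
    refine hfx (h1.symm.trans ((ZMod.intCast_zmod_eq_zero_iff_dvd _ _).2 ?_))
    rw [← hk]
    exact hpd'.mul_left k
  obtain ⟨u, v, huv⟩ := hcop
  have hmem : u * d ∈ (L j).map χ := by
    rw [hd]
    exact Submodule.mem_span_singleton.2 ⟨u, rfl⟩
  obtain ⟨x, hx, hxd⟩ := hmem
  exact ⟨x, hx, ⟨-v, by rw [hxd]; linear_combination huv⟩⟩

/-! ### Intersection numbers under local biholomorphisms and étale covers -/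

noncomputable section

section LocalInvariance

variable {E : Type*} [NormedAddCommGroup E] [NormedSpace ℂ E]
  {E' : Type*} [NormedAddCommGroup E'] [NormedSpace ℂ E']
  {H : Type*} [TopologicalSpace H] {I : ModelWithCorners ℂ E H}
  {H' : Type*} [TopologicalSpace H'] {I' : ModelWithCorners ℂ E' H'}
  {Y : Type*} [TopologicalSpace Y] [ChartedSpace H Y]
  {X : Type*} [TopologicalSpace X] [ChartedSpace H' X]

theorem PartialDiffeomorph.contMDiffAt (Φ : PartialDiffeomorph I I' Y X ω) {y : Y}
    (hy : y ∈ Φ.source) : ContMDiffAt I I' ω Φ y :=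
  Φ.contMDiffOn.contMDiffAt (Φ.open_source.mem_nhds hy)

theorem PartialDiffeomorph.mfderiv_bijective (Φ : PartialDiffeomorph I I' Y X ω) {y : Y}
    (hy : y ∈ Φ.source) : Function.Bijective (mfderiv I I' Φ y) :=
  ((Φ.isLocalDiffeomorphAt _ _ _ hy).mfderivToContinuousLinearEquiv (by simp)).bijective

theorem IsLocalParametrization.partialDiffeomorph_comp {C : Set Y} {C' : Set X} {y : Y}
    (Φ : PartialDiffeomorph I I' Y X ω) (hy : y ∈ Φ.source)
    (hC : ∀ z ∈ Φ.source, z ∈ C ↔ Φ z ∈ C') {g : ℂ → Y} (hg : IsLocalParametrization I C y g) :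
    IsLocalParametrization I' C' (Φ y) (Φ ∘ g) where
  map_zero := congrArg Φ hg.map_zero
  holomorphic := by
    refine ContMDiffAt.comp (0 : ℂ) ?_ hg.holomorphic
    rw [hg.map_zero]
    exact Φ.contMDiffAt hy
  immersive := by
    have hy0 : g 0 ∈ Φ.source := by rwa [hg.map_zero]
    rw [mfderiv_comp (0 : ℂ) (Φ.mdifferentiableAt (by simp) hy0)
      (hg.holomorphic.mdifferentiableAt (by simp))]
    exact (Φ.mfderiv_bijective hy0).1.comp hg.immersive
  map_nhds := by
    have h : 𝓝[C] y = 𝓝[Φ ⁻¹' C'] y := by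
      refine nhdsWithin_eq_iff_eventuallyEq.2 ?_
      filter_upwards [Φ.open_source.mem_nhds hy] with z hz
      exact propext (hC z hz)
    rw [← Filter.map_map, hg.map_nhds, h]
    exact Φ.toOpenPartialHomeomorph.map_nhdsWithin_preimage_eq hy C'

theorem IsLocalEquation.comp_partialDiffeomorph {D : Set Y} {D' : Set X} {y : Y}
    (Φ : PartialDiffeomorph I I' Y X ω) (hy : y ∈ Φ.source)
    (hD : ∀ z ∈ Φ.source, z ∈ D ↔ Φ z ∈ D') {h : X → ℂ} (hh : IsLocalEquation I' D' (Φ y) h) :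
    IsLocalEquation I D y (h ∘ Φ) where
  holomorphic := ContMDiffAt.comp y hh.holomorphic (Φ.contMDiffAt hy)
  submersive := by
    rw [mfderiv_comp y (hh.holomorphic.mdifferentiableAt (by simp))
      (Φ.mdifferentiableAt (by simp) hy)]
    exact hh.submersive.comp (Φ.mfderiv_bijective hy).2
  eventually_mem_iff := by
    filter_upwards [(Φ.contMDiffAt hy).continuousAt.eventually hh.eventually_mem_iff,
      Φ.open_source.mem_nhds hy] with z hz hzs
    exact (hD z hzs).trans hz

/-- A pair (g, h) on `Y` transports to (Φ ∘ g, h ∘ Φ⁻¹) on `X` with the same composite near 0, so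
the infimum on `X` is no larger. Applied also to Φ⁻¹ this gives equality, without knowing that the
order is independent of the choices. -/
theorem intersectionMultiplicity_le_of_partialDiffeomorph {C D : Set Y} {C' D' : Set X} {y : Y}
    (Φ : PartialDiffeomorph I I' Y X ω) (hy : y ∈ Φ.source)
    (hC : ∀ z ∈ Φ.source, z ∈ C ↔ Φ z ∈ C') (hD : ∀ z ∈ Φ.source, z ∈ D ↔ Φ z ∈ D') :
    intersectionMultiplicity I' C' D' (Φ y) ≤ intersectionMultiplicity I C D y := by
  refine le_iInf₂ fun g hg => le_iInf₂ fun h hh => ?_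
  have hΦy : Φ y ∈ Φ.symm.source := Φ.map_source hy
  have hsy : Φ.symm (Φ y) = y := Φ.left_inv hy
  have hmem : ∀ (C : Set Y) (C' : Set X), (∀ z ∈ Φ.source, z ∈ C ↔ Φ z ∈ C') →
      ∀ x ∈ Φ.symm.source, x ∈ C' ↔ Φ.symm x ∈ C := fun C C' hC x hx => by
    rw [hC _ (Φ.symm.map_source hx)]
    exact iff_of_eq (congrArg (· ∈ C') (Φ.right_inv hx)).symm
  have hh' : IsLocalEquation I' D' (Φ y) (h ∘ Φ.symm) :=
    IsLocalEquation.comp_partialDiffeomorph (I := I') (I' := I) Φ.symm hΦy (hmem D D' hD)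
      (by rwa [hsy])
  have hg' := hg.partialDiffeomorph_comp Φ hy hC
  refine (iInf₂_le _ hg').trans ((iInf₂_le _ hh').trans (le_of_eq ?_))
  refine analyticOrderAt_congr ?_
  have hev : ∀ᶠ z in 𝓝 (0 : ℂ), g z ∈ Φ.source :=
    hg.holomorphic.continuousAt.eventually (Φ.open_source.mem_nhds (by rwa [hg.map_zero]))
  filter_upwards [hev] with z hz
  exact congrArg h (Φ.left_inv hz)

/-- Local intersection multiplicities are invariant under local biholomorphisms. -/
theorem intersectionMultiplicity_preimage {π : Y → X} (hπ : IsLocalDiffeomorph I I' ω π)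
    (C D : Set X) (y : Y) :
    intersectionMultiplicity I (π ⁻¹' C) (π ⁻¹' D) y = intersectionMultiplicity I' C D (π y) := by
  obtain ⟨Φ, hy, hΦ⟩ := hπ y
  have hmem : ∀ C : Set X, ∀ z ∈ Φ.source, z ∈ π ⁻¹' C ↔ Φ z ∈ C := fun C z hz => by
    rw [← hΦ hz, Set.mem_preimage]
  have hmem' : ∀ C : Set X, ∀ x ∈ Φ.symm.source, x ∈ C ↔ Φ.symm x ∈ π ⁻¹' C := fun C x hx => by
    rw [hmem C _ (Φ.symm.map_source hx)]
    exact iff_of_eq (congrArg (· ∈ C) (Φ.right_inv hx)).symm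
  rw [hΦ hy]
  refine le_antisymm ?_ (intersectionMultiplicity_le_of_partialDiffeomorph Φ hy (hmem C) (hmem D))
  have h := intersectionMultiplicity_le_of_partialDiffeomorph (I := I') (I' := I) Φ.symm
    (Φ.map_source hy) (hmem' C) (hmem' D)
  have hsy : Φ.symm (Φ y) = y := Φ.left_inv hy
  rwa [hsy] at h

/-- Summing a function on the base of an `e`-to-one map over the total space. -/
theorem finsum_mem_preimage_of_encard_fiber {α β M : Type*} [AddCommMonoid M] [IsAddTorsionFree M]
    (π : α → β) {e : ℕ} (he : e ≠ 0) (hπ : ∀ x, Set.encard (π ⁻¹' {x}) = e) (s : Set β)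
    (m : β → M) : ∑ᶠ y ∈ π ⁻¹' s, m (π y) = e • ∑ᶠ x ∈ s, m x := by
  classical
  let n : β → M := fun x => ∑ᶠ _ : x ∈ s, m x
  change ∑ᶠ y, n (π y) = e • ∑ᶠ x, n x
  have hfin : ∀ x, (π ⁻¹' {x}).Finite := fun x =>
    Set.finite_of_encard_le_coe (k := e) (hπ x).le
  have hsurj : Function.Surjective π := fun x => by
    have : (π ⁻¹' {x}).Nonempty := by
      rw [← Set.encard_ne_zero, hπ]
      exact_mod_cast he
    exact this
  by_cases hs : (Function.support n).Finite
  · have hs' : (Function.support fun y => n (π y)).Finite :=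
      hs.preimage' fun x _ => hfin x
    rw [finsum_eq_sum_of_support_subset _ (s := hs'.toFinset) (by simp),
      finsum_eq_sum_of_support_subset _ (s := hs.toFinset) (by simp), Finset.smul_sum,
      ← Finset.sum_fiberwise_of_maps_to (g := π) (t := hs.toFinset) (fun y hy => by simpa using hy)]
    refine Finset.sum_congr rfl fun x hx => ?_
    rw [Finset.sum_congr rfl (g := fun _ => n x)
      (fun y hy => congrArg n (Finset.mem_filter.1 hy).2), Finset.sum_const]
    congr 1
    have : ((hs'.toFinset.filter fun y => π y = x : Finset α) : Set α) = π ⁻¹' {x} := by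
      ext y
      simp only [Finset.coe_filter, Set.Finite.mem_toFinset, Function.mem_support,
        Set.mem_ofPred_eq, Set.mem_preimage, Set.mem_singleton_iff, and_iff_right_iff_imp]
      rintro rfl
      simpa using hx
    have h := hπ x
    rw [← this, Set.encard_coe_eq_coe_finsetCard] at h
    exact_mod_cast h
  -- With infinite support both sums take the default value 0.
  · have hs' : ¬ (Function.support fun y => n (π y)).Finite := fun h => hs <| by
      have := h.image π
      rwa [show (Function.support fun y => n (π y)) = π ⁻¹' Function.support n from rfl,
        Set.image_preimage_eq _ hsurj] at this
    rw [finsum_of_infinite_support hs, finsum_of_infinite_support hs', smul_zero]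

/-- Intersection numbers are multiplied by the degree under étale covers. -/
theorem IsEtaleCover.intersectionNumber_preimage {e : ℕ} {π : Y → X}
    (hπ : IsEtaleCover I I' e π) (C D : Set X) :
    intersectionNumber I (π ⁻¹' C) (π ⁻¹' D) = e * intersectionNumber I' C D := by
  unfold intersectionNumber
  simp only [intersectionMultiplicity_preimage hπ.isLocalDiffeomorph, ← Set.preimage_inter]
  exact finsum_mem_preimage_of_encard_fiber π hπ.degree_ne_zero hπ.card_fiber (C ∩ D)
    fun x => (intersectionMultiplicity I' C D x).toNat

end LocalInvariance

/-! ### Local biholomorphisms of products and of torus quotients -/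

section ProdMap

variable {𝕜 : Type*} [NontriviallyNormedField 𝕜]
  {E F E' F' : Type*} [NormedAddCommGroup E] [NormedSpace 𝕜 E]
  [NormedAddCommGroup F] [NormedSpace 𝕜 F]
  [NormedAddCommGroup E'] [NormedSpace 𝕜 E']
  [NormedAddCommGroup F'] [NormedSpace 𝕜 F']
  {H G H' G' : Type*} [TopologicalSpace H] [TopologicalSpace G]
  [TopologicalSpace H'] [TopologicalSpace G']
  {I : ModelWithCorners 𝕜 E H} {J : ModelWithCorners 𝕜 F G}
  {I' : ModelWithCorners 𝕜 E' H'} {J' : ModelWithCorners 𝕜 F' G'}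
  {M N M' N' : Type*} [TopologicalSpace M] [ChartedSpace H M]
  [TopologicalSpace N] [ChartedSpace G N]
  [TopologicalSpace M'] [ChartedSpace H' M']
  [TopologicalSpace N'] [ChartedSpace G' N'] {n : WithTop ℕ∞}

/-- The product of two partial diffeomorphisms. -/
def PartialDiffeomorph.prod (Φ : PartialDiffeomorph I J M N n)
    (Ψ : PartialDiffeomorph I' J' M' N' n) :
    PartialDiffeomorph (I.prod I') (J.prod J') (M × M') (N × N') n where
  toPartialEquiv := Φ.toPartialEquiv.prod Ψ.toPartialEquiv
  open_source := Φ.open_source.prod Ψ.open_source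
  open_target := Φ.open_target.prod Ψ.open_target
  contMDiffOn_toFun := Φ.contMDiffOn_toFun.prodMap Ψ.contMDiffOn_toFun
  contMDiffOn_invFun := Φ.contMDiffOn_invFun.prodMap Ψ.contMDiffOn_invFun

theorem IsLocalDiffeomorph.prodMap {f : M → N} {g : M' → N'} (hf : IsLocalDiffeomorph I J n f)
    (hg : IsLocalDiffeomorph I' J' n g) :
    IsLocalDiffeomorph (I.prod I') (J.prod J') n (Prod.map f g) := by
  rintro ⟨x, y⟩
  obtain ⟨Φ, hx, hΦ⟩ := hf x
  obtain ⟨Ψ, hy, hΨ⟩ := hg y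
  exact ⟨Φ.prod Ψ, ⟨hx, hy⟩, fun z hz => Prod.ext (hΦ hz.1) (hΨ hz.2)⟩

end ProdMap

namespace ComplexTorus

variable {V : Type*} [NormedAddCommGroup V] [NormedSpace ℂ V]

/-- The quotient map onto a complex torus is a local biholomorphism. -/
theorem isLocalDiffeomorph_mk (Λ : Submodule ℤ V) [DiscreteTopology Λ] :
    IsLocalDiffeomorph 𝓘(ℂ, V) 𝓘(ℂ, V) ω (mk Λ) := by
  intro v
  let c := chartAt V (mk Λ v)
  have hc : c ∈ atlas V (ComplexTorus Λ) := chart_mem_atlas V _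
  have hv : mk Λ v ∈ c.source := mem_chart_source V _
  -- The inverse chart agrees with `mk Λ` near c(mk v), which differs from v by a lattice vector.
  -- Translation by that vector does not change `mk Λ`.
  let t : V ≃ₘ^ω⟮𝓘(ℂ, V), 𝓘(ℂ, V)⟯ V :=
    { Equiv.addRight (c (mk Λ v) - v) with
      contMDiff_toFun := (contDiff_id.add contDiff_const).contMDiff
      contMDiff_invFun := (contDiff_id.add contDiff_const).contMDiff }
  let Φ : PartialDiffeomorph 𝓘(ℂ, V) 𝓘(ℂ, V) V (ComplexTorus Λ) ω :=
    { c.symm with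
      contMDiffOn_toFun := contMDiffOn_chart_symm
      contMDiffOn_invFun := contMDiffOn_chart }
  have htv : t v = c (mk Λ v) := add_sub_cancel v _
  have hΦ : IsLocalDiffeomorphAt 𝓘(ℂ, V) 𝓘(ℂ, V) ω (mk Λ) (t v) := by
    refine ⟨Φ, ?_, fun w hw => ?_⟩
    · rw [htv]
      exact c.map_source hv
    · have h := mk_chart Λ hc (c.map_target hw)
      rwa [c.right_inv hw] at h
  have h := (t.isLocalDiffeomorph v).comp (K := 𝓘(ℂ, V)) (P := ComplexTorus Λ) hΦ
  have hmk : mk Λ ∘ t = mk Λ := funext fun w => by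
    refine (mk_eq_mk Λ).2 ?_
    have h1 := (mk_eq_mk Λ).1 (mk_chart Λ hc hv)
    have h2 : w - t w = v - c (mk Λ v) := by
      change w - (w + (c (mk Λ v) - v)) = _
      abel
    rwa [h2]
  rwa [hmk] at h

end ComplexTorus
end

/-! ### Tori in a product are images of affine lines -/

noncomputable section

namespace ComplexTorus

/-- A holomorphic function on `ℂ` which changes by a constant under each translation in a lattice
is affine. -/
theorem exists_affine_of_quasiperiodic (M : Submodule ℤ ℂ) [DiscreteTopology M] [IsZLattice ℝ M]
    {F : ℂ → ℂ} (hF : Differentiable ℂ F) (hM : ∀ m ∈ M, ∃ k, ∀ z, F (z + m) = F z + k) :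
    ∃ a c : ℂ, ∀ z, F z = a * z + c := by
  have hd : Differentiable ℂ (deriv F) := fun z =>
    ((hF.differentiableOn (s := Set.univ)).deriv isOpen_univ).differentiableAt Filter.univ_mem
  have hper : ∀ z m, m ∈ M → deriv F (z + m) = deriv F z := fun z m hm => by
    obtain ⟨k, hk⟩ := hM m hm
    rw [← deriv_comp_add_const F m z, funext hk, deriv_add_const]
  -- The derivative is periodic, hence bounded, hence constant by Liouville.
  obtain ⟨a, ha⟩ := hd.exists_const_forall_eq_of_bounded
    (IsZLattice.isCompact_range_of_periodic M _ hd.continuous hper).isBounded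
  refine ⟨a, F 0, fun z => ?_⟩
  have h0 : ∀ w, deriv (fun z => F z - a * z) w = 0 := fun w => by
    have h1 : HasDerivAt (fun z => F z - a * z) (deriv F w - a * 1) w :=
      (hF w).hasDerivAt.sub ((hasDerivAt_id w).const_mul a)
    rw [h1.deriv, ha, mul_one, sub_self]
  have h2 : F z - a * z = F 0 - a * 0 := is_const_of_deriv_eq_zero
    (hF.sub (differentiable_id.const_mul a)) h0 z 0
  linear_combination h2

/-- Holomorphic maps between one-dimensional complex tori are affine. -/
theorem exists_affine_lift (M Λ : Submodule ℤ ℂ) [DiscreteTopology M] [IsZLattice ℝ M]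
    [DiscreteTopology Λ] {g : ComplexTorus M → ComplexTorus Λ}
    (hg : ContMDiff 𝓘(ℂ, ℂ) 𝓘(ℂ, ℂ) ω g) :
    ∃ a c : ℂ, ∀ z, g (mk M z) = mk Λ (a * z + c) := by
  have hgc : Continuous fun z => g (mk M z) :=
    hg.continuous.comp (isCoveringMap_mk M).continuous
  obtain ⟨w, hw⟩ := mk_surjective Λ (g (mk M 0))
  obtain ⟨F, ⟨-, hF⟩, -⟩ := (isCoveringMap_mk Λ).existsUnique_continuousMap_lifts
    ⟨_, hgc⟩ (0 : ℂ) w hw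
  replace hF : ∀ z, mk Λ (F z) = g (mk M z) := fun z => congrFun hF z
  have hdiff : Differentiable ℂ F := by
    intro z
    have hloc := isLocalDiffeomorph_mk Λ (F z)
    have h1 : ContMDiffAt 𝓘(ℂ, ℂ) 𝓘(ℂ, ℂ) ω (fun z => mk Λ (F z)) z := by
      simp only [hF]
      exact (hg.comp (isLocalDiffeomorph_mk M).contMDiff).contMDiffAt
    have h2 : ContMDiffAt 𝓘(ℂ, ℂ) 𝓘(ℂ, ℂ) ω (fun z => hloc.localInverse (mk Λ (F z))) z :=
      ContMDiffAt.comp z hloc.localInverse_contMDiffAt h1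
    have h3 : (fun z => hloc.localInverse (mk Λ (F z))) =ᶠ[𝓝 z] F :=
      F.continuous.continuousAt.eventually hloc.localInverse_eventuallyEq_left
    exact (h2.congr_of_eventuallyEq h3.symm).contDiffAt.differentiableAt (by simp)
  have hM : ∀ m ∈ M, ∃ k, ∀ z, F (z + m) = F z + k := by
    intro m hm
    have hmem : ∀ z, F (z + m) - F z ∈ Λ := fun z => by
      rw [← mk_eq_mk, hF, hF]
      congr 1
      rw [mk_eq_mk]
      simpa using hm
    -- A continuous map from ℂ to the discrete space Λ is constant.
    let G : ℂ → Λ := fun z => ⟨F (z + m) - F z, hmem z⟩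
    have hG : Continuous G := Continuous.subtype_mk (by fun_prop) _
    refine ⟨F (0 + m) - F 0, fun z => ?_⟩
    have h := congrArg Subtype.val (PreconnectedSpace.constant inferInstance hG (x := z) (y := 0))
    exact sub_eq_iff_eq_add'.1 h
  obtain ⟨a, c, h⟩ := exists_affine_of_quasiperiodic M hdiff hM
  exact ⟨a, c, fun z => by rw [← hF, h]⟩

end ComplexTorus

open ComplexTorus in
/-- A torus in a product of two one-dimensional complex tori is the image of an affine line. -/
theorem IsTorusIn.exists_affine {Λ Λ' : Submodule ℤ ℂ} [DiscreteTopology Λ] [DiscreteTopology Λ']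
    {C : Set (ComplexTorus Λ × ComplexTorus Λ')}
    (hC : IsTorusIn (𝓘(ℂ, ℂ).prod 𝓘(ℂ, ℂ)) C) :
    ∃ (M : Submodule ℤ ℂ) (_ : DiscreteTopology M) (_ : IsZLattice ℝ M) (a a' c c' : ℂ),
      C = Set.range (fun z => (mk Λ (a * z + c), mk Λ' (a' * z + c'))) ∧
        ∀ z, z ∈ M ↔ a * z ∈ Λ ∧ a' * z ∈ Λ' := by
  obtain ⟨M, hM, hM', f, hf, rfl⟩ := hC
  have hfs : ContMDiff 𝓘(ℂ, ℂ) (𝓘(ℂ, ℂ).prod 𝓘(ℂ, ℂ)) ω f := hf.isImmersion.contMDiff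
  obtain ⟨a, c, h⟩ := exists_affine_lift M Λ (contMDiff_fst.comp hfs)
  obtain ⟨a', c', h'⟩ := exists_affine_lift M Λ' (contMDiff_snd.comp hfs)
  have hfz : ∀ z, f (mk M z) = (mk Λ (a * z + c), mk Λ' (a' * z + c')) :=
    fun z => Prod.ext (h z) (h' z)
  refine ⟨M, hM, hM', a, a', c, c', ?_, fun z => ?_⟩
  · rw [← (mk_surjective M).range_comp f]
    exact congrArg Set.range (funext hfz)
  · have h1 : z ∈ M ↔ f (mk M 0) = f (mk M z) := by
      rw [hf.isEmbedding.injective.eq_iff, mk_eq_mk, sub_zero]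
    rw [h1, hfz, hfz, Prod.mk.injEq, mk_eq_mk, mk_eq_mk]
    simp

end

/-! ### The étale cover attached to a sublattice -/

noncomputable section

theorem IsLocalDiffeomorph.of_comp {𝕜 : Type*} [NontriviallyNormedField 𝕜]
    {E F F' : Type*} [NormedAddCommGroup E] [NormedSpace 𝕜 E]
    [NormedAddCommGroup F] [NormedSpace 𝕜 F] [NormedAddCommGroup F'] [NormedSpace 𝕜 F']
    {H G G' : Type*} [TopologicalSpace H] [TopologicalSpace G] [TopologicalSpace G']
    {I : ModelWithCorners 𝕜 E H} {J : ModelWithCorners 𝕜 F G} {K : ModelWithCorners 𝕜 F' G'}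
    {M N P : Type*} [TopologicalSpace M] [ChartedSpace H M] [TopologicalSpace N]
    [ChartedSpace G N] [TopologicalSpace P] [ChartedSpace G' P] {n : WithTop ℕ∞}
    {f : M → N} {g : N → P} (hf : IsLocalDiffeomorph I J n f) (hfs : Function.Surjective f)
    (hgf : IsLocalDiffeomorph I K n (g ∘ f)) : IsLocalDiffeomorph J K n g := by
  intro y
  obtain ⟨x, rfl⟩ := hfs y
  obtain ⟨Φ, hx, hΦ⟩ := hf x
  obtain ⟨Ψ, hx', hΨ⟩ := hgf x
  refine ⟨Φ.symm.trans Ψ, ⟨?_, ?_⟩, fun z hz => ?_⟩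
  · rw [hΦ hx]
    exact Φ.map_source hx
  · have h : Φ.symm (f x) = x := (congrArg Φ.symm (hΦ hx)).trans (Φ.left_inv hx)
    change Φ.symm (f x) ∈ Ψ.source
    rwa [h]
  · have h1 : f (Φ.symm z) = z := (hΦ (Φ.symm.map_source hz.1)).trans (Φ.right_inv hz.1)
    have h2 : (g ∘ f) (Φ.symm z) = Ψ (Φ.symm z) := hΨ hz.2
    rw [Function.comp_apply, h1] at h2
    exact h2

namespace ComplexTorus

/-- The homomorphism from a complex torus to a product of tori with larger lattices. -/
def toProd {Λ Λ' : Submodule ℤ ℂ} {Γ : Submodule ℤ (ℂ × ℂ)} (h : Γ ≤ Λ.prod Λ') :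
    ComplexTorus Γ →+ ComplexTorus Λ × ComplexTorus Λ' :=
  QuotientAddGroup.lift Γ.toAddSubgroup
    ((QuotientAddGroup.mk' Λ.toAddSubgroup).prodMap (QuotientAddGroup.mk' Λ'.toAddSubgroup))
    fun _ hv => Prod.ext ((QuotientAddGroup.eq_zero_iff _).2 (h hv).1)
      ((QuotientAddGroup.eq_zero_iff _).2 (h hv).2)

section toProd

variable {Λ Λ' : Submodule ℤ ℂ} {Γ : Submodule ℤ (ℂ × ℂ)} (h : Γ ≤ Λ.prod Λ')

theorem toProd_mk (v : ℂ × ℂ) : toProd h (mk Γ v) = (mk Λ v.1, mk Λ' v.2) :=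
  rfl

theorem toProd_mk_eq_toProd_mk {v w : ℂ × ℂ} :
    toProd h (mk Γ v) = toProd h (mk Γ w) ↔ w - v ∈ Λ.prod Λ' := by
  rw [toProd_mk, toProd_mk, Prod.mk.injEq, mk_eq_mk, mk_eq_mk]
  rfl

theorem toProd_surjective : Function.Surjective (toProd h) := by
  rintro ⟨x, y⟩
  obtain ⟨v, rfl⟩ := mk_surjective Λ x
  obtain ⟨w, rfl⟩ := mk_surjective Λ' y
  exact ⟨mk Γ (v, w), rfl⟩

variable [DiscreteTopology Λ] [DiscreteTopology Λ'] [DiscreteTopology Γ]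

theorem isLocalDiffeomorph_toProd :
    IsLocalDiffeomorph 𝓘(ℂ, ℂ × ℂ) (𝓘(ℂ, ℂ).prod 𝓘(ℂ, ℂ)) ω (toProd h) := by
  refine (isLocalDiffeomorph_mk Γ).of_comp (mk_surjective Γ) ?_
  have := (isLocalDiffeomorph_mk Λ).prodMap (isLocalDiffeomorph_mk Λ')
  rw [modelWithCornersSelf_prod, ← chartedSpaceSelf_prod]
  exact this

theorem isCoveringMap_toProd : IsCoveringMap (toProd h) := by
  have hloc := (isLocalDiffeomorph_toProd h).isLocalHomeomorph
  refine (Topology.IsQuotientMap.isAddQuotientCoveringMap_of_isDiscrete_ker_addMonoidHom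
    (hloc.isOpenMap.isQuotientMap hloc.continuous (toProd_surjective h)) ?_).isCoveringMap
  -- The kernel is discrete because it is a fibre of a local homeomorphism.
  refine IsDiscrete.of_openPartialHomeomorph (toProd h) (x := 0) (fun x hx => hx) fun x _ => ?_
  obtain ⟨φ, hx, hφ⟩ := hloc x
  exact ⟨φ, hx, hφ.symm⟩

instance instConnectedSpace {V : Type*} [NormedAddCommGroup V] [NormedSpace ℂ V]
    (Γ : Submodule ℤ V) : ConnectedSpace (ComplexTorus Γ) :=
  have : NormedSpace ℝ V := NormedSpace.restrictScalars ℝ ℂ V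
  have : Continuous (mk Γ) := continuous_quotient_mk'
  (mk_surjective Γ).connectedSpace this

end toProd

/-! ### The sublattice of a functional, and lattice points on a line -/

section lattice

variable (Λ Λ' : Submodule ℤ ℂ)

/-- The sublattice of `Λ × Λ'` on which the functional `χ` is divisible by `e`. -/
def sublattice (χ : Λ × Λ' →ₗ[ℤ] ℤ) (e : ℕ) : Submodule ℤ (ℂ × ℂ) :=
  ((Submodule.span ℤ {(e : ℤ)}).comap χ).map (Λ.subtype.prodMap Λ'.subtype)

variable {Λ Λ'} {χ : Λ × Λ' →ₗ[ℤ] ℤ} {e : ℕ}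

theorem coe_mem_sublattice {x : Λ × Λ'} :
    ((x.1 : ℂ), (x.2 : ℂ)) ∈ sublattice Λ Λ' χ e ↔ (e : ℤ) ∣ χ x := by
  constructor
  · rintro ⟨y, hy, hyx⟩
    have : y = x := Prod.ext (Subtype.ext congr(($hyx).1)) (Subtype.ext congr(($hyx).2))
    rw [← this]
    exact Submodule.mem_span_singleton.1 hy |>.imp fun k hk => by rw [← hk, smul_eq_mul, mul_comm]
  · rintro ⟨k, hk⟩
    exact ⟨x, Submodule.mem_span_singleton.2 ⟨k, by rw [hk, smul_eq_mul, mul_comm]⟩, rfl⟩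

theorem sublattice_le : sublattice Λ Λ' χ e ≤ Λ.prod Λ' := by
  rintro _ ⟨x, -, rfl⟩
  exact ⟨x.1.2, x.2.2⟩

instance instDiscreteTopologyProd [DiscreteTopology Λ] [DiscreteTopology Λ'] :
    DiscreteTopology (Λ.prod Λ') := by
  let f : Λ.prod Λ' → Λ × Λ' := fun x => (⟨x.1.1, x.2.1⟩, ⟨x.1.2, x.2.2⟩)
  have hf : Continuous f := by fun_prop
  refine DiscreteTopology.of_continuous_injective hf fun x y hxy => ?_
  exact Subtype.ext (Prod.ext congr(($hxy).1) congr(($hxy).2))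

instance instDiscreteTopologySublattice [DiscreteTopology Λ] [DiscreteTopology Λ'] :
    DiscreteTopology (sublattice Λ Λ' χ e) :=
  have : DiscreteTopology ((Λ.prod Λ' : Submodule ℤ (ℂ × ℂ)) : Set (ℂ × ℂ)) :=
    instDiscreteTopologyProd
  DiscreteTopology.of_continuous_injective
    (continuous_inclusion (s := (sublattice Λ Λ' χ e : Set (ℂ × ℂ))) (t := (Λ.prod Λ' : Set (ℂ × ℂ)))
      sublattice_le) (Set.inclusion_injective sublattice_le)

/-- Since χ(l) ≡ 1 mod e, the class of `l` generates (Λ × Λ')/Γ ≅ ℤ/e, so the fibre through v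
consists of the classes of v + k l for 0 ≤ k < e. -/
theorem encard_toProd_fiber (he : e ≠ 0) {l : Λ × Λ'} (hl : (e : ℤ) ∣ χ l - 1)
    (x : ComplexTorus Λ × ComplexTorus Λ') :
    Set.encard (toProd (sublattice_le (χ := χ) (e := e)) ⁻¹' {x}) = e := by
  obtain ⟨y, rfl⟩ := toProd_surjective (sublattice_le (χ := χ) (e := e)) x
  obtain ⟨v, rfl⟩ := mk_surjective _ y
  let l' : ℂ × ℂ := (l.1, l.2)
  let f : Fin e → ComplexTorus (sublattice Λ Λ' χ e) := fun k => mk _ (v + (k : ℤ) • l')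
  have hmem : ∀ (u : Λ × Λ') (k : ℤ), ((u.1 : ℂ), (u.2 : ℂ)) - k • l' ∈ sublattice Λ Λ' χ e ↔
      (e : ℤ) ∣ χ u - k := fun u k => by
    have h1 : ((u.1 : ℂ), (u.2 : ℂ)) - k • l' =
        (((u - k • l).1 : ℂ), ((u - k • l).2 : ℂ)) := rfl
    rw [h1, coe_mem_sublattice, map_sub, map_smul, smul_eq_mul]
    have h2 : χ u - k * χ l = (χ u - k) - k * (χ l - 1) := by ring
    rw [h2]
    exact dvd_sub_left (hl.mul_left k)
  have hf : Function.Injective f := by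
    intro i j hij
    have h1 := (mk_eq_mk _).1 hij
    have h2 : (v + (j : ℤ) • l') - (v + (i : ℤ) • l') =
        ((((j : ℤ) • l).1 : ℂ), (((j : ℤ) • l).2 : ℂ)) - (i : ℤ) • l' := by
      rw [add_sub_add_left_eq_sub]
      rfl
    rw [h2, hmem, map_smul, smul_eq_mul] at h1
    have h3 : (e : ℤ) ∣ (j : ℤ) - i := by
      have h4 : ((j : ℤ) - i) = ((j : ℤ) * χ l - i) - j * (χ l - 1) := by ring
      rw [h4]
      exact dvd_sub h1 (hl.mul_left _)
    have h5 := Int.eq_zero_of_abs_lt_dvd h3 (by rw [abs_lt]; omega)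
    omega
  have hrange : toProd (sublattice_le (χ := χ) (e := e)) ⁻¹'
      {toProd sublattice_le (mk (sublattice Λ Λ' χ e) v)} = Set.range f := by
    ext y
    obtain ⟨w, rfl⟩ := mk_surjective _ y
    rw [Set.mem_preimage, Set.mem_singleton_iff, eq_comm, toProd_mk_eq_toProd_mk]
    constructor
    · intro hw
      let u : Λ × Λ' := (⟨(w - v).1, hw.1⟩, ⟨(w - v).2, hw.2⟩)
      have he' : (0 : ℤ) < e := by omega
      have h0 := Int.emod_nonneg (χ u) he'.ne'
      have h1 := Int.emod_lt_of_pos (χ u) he'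
      refine ⟨⟨(χ u % e).toNat, by omega⟩, (mk_eq_mk _).2 ?_⟩
      have h2 := (hmem u (χ u % e)).2 (Int.dvd_self_sub_emod)
      simp only [Int.toNat_of_nonneg h0]
      rwa [← sub_sub]
    · rintro ⟨k, hk⟩
      have h1 := sublattice_le ((mk_eq_mk _).1 hk)
      have h2 : (k : ℤ) • l' ∈ Λ.prod Λ' := Submodule.smul_mem _ _ ⟨l.1.2, l.2.2⟩
      have h3 := Submodule.add_mem _ h1 h2
      rwa [← sub_sub, sub_add_cancel] at h3
  rw [hrange, ← Set.image_univ, hf.encard_image]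
  simp

theorem isEtaleCover_toProd [DiscreteTopology Λ] [DiscreteTopology Λ'] (he : e ≠ 0)
    {l : Λ × Λ'} (hl : (e : ℤ) ∣ χ l - 1) :
    IsEtaleCover 𝓘(ℂ, ℂ × ℂ) (𝓘(ℂ, ℂ).prod 𝓘(ℂ, ℂ)) e
      (toProd (sublattice_le (χ := χ) (e := e))) where
  connected := inferInstance
  isCoveringMap := isCoveringMap_toProd _
  isLocalDiffeomorph := isLocalDiffeomorph_toProd _
  degree_ne_zero := he
  card_fiber := encard_toProd_fiber he hl

/-- Every u in Λ × Λ' is congruent to χ(u) l modulo Γ, and `l` lies along the line. Hence the whole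
preimage is the image of the single line ℂ. -/
theorem isConnected_toProd_preimage (a a' c c' : ℂ) {l : Λ × Λ'} (hl : (e : ℤ) ∣ χ l - 1)
    (hla : ∃ m : ℂ, l.1 = a * m ∧ l.2 = a' * m) :
    IsConnected (toProd (sublattice_le (χ := χ) (e := e)) ⁻¹'
      Set.range fun z => (mk Λ (a * z + c), mk Λ' (a' * z + c'))) := by
  obtain ⟨m, hm, hm'⟩ := hla
  have hrange : toProd (sublattice_le (χ := χ) (e := e)) ⁻¹'
      (Set.range fun z => (mk Λ (a * z + c), mk Λ' (a' * z + c'))) =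
      Set.range fun z => mk (sublattice Λ Λ' χ e) (a * z + c, a' * z + c') := by
    ext y
    obtain ⟨w, rfl⟩ := mk_surjective _ y
    constructor
    · rintro ⟨z, hz⟩
      have hz1 : w.1 - (a * z + c) ∈ Λ := (mk_eq_mk Λ).1 congr(($hz).1)
      have hz2 : w.2 - (a' * z + c') ∈ Λ' := (mk_eq_mk Λ').1 congr(($hz).2)
      let u : Λ × Λ' := (⟨_, hz1⟩, ⟨_, hz2⟩)
      -- Moving the parameter by χ(u) m replaces u by u − χ(u) l, which lies in Γ.
      refine ⟨z + χ u * m, (mk_eq_mk _).2 ?_⟩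
      have h1 : w - (a * (z + χ u * m) + c, a' * (z + χ u * m) + c') =
          (((u - χ u • l).1 : ℂ), ((u - χ u • l).2 : ℂ)) := by
        refine Prod.ext ?_ ?_
        · simp only [Prod.fst_sub, Prod.smul_fst, Submodule.coe_sub, Submodule.coe_smul, hm, u,
            zsmul_eq_mul]
          ring
        · simp only [Prod.snd_sub, Prod.smul_snd, Submodule.coe_sub, Submodule.coe_smul, hm', u,
            zsmul_eq_mul]
          ring
      rw [h1, coe_mem_sublattice, map_sub, map_smul, smul_eq_mul]
      have h2 : χ u - χ u * χ l = -χ u * (χ l - 1) := by ring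
      rw [h2]
      exact hl.mul_left _
    · rintro ⟨z, hz⟩
      exact ⟨z, by rw [← hz]; rfl⟩
  rw [hrange]
  refine isConnected_range ?_
  have : Continuous (mk (sublattice Λ Λ' χ e)) := continuous_quotient_mk'
  exact this.comp (by fun_prop)

/-- The subgroup of `Λ × Λ'` of lattice points on a line. -/
def lineLattice (Λ Λ' : Submodule ℤ ℂ) (a a' : ℂ) : Submodule ℤ (Λ × Λ') where
  carrier := {x | ∃ m : ℂ, x.1 = a * m ∧ x.2 = a' * m}
  zero_mem' := ⟨0, by simp, by simp⟩
  add_mem' := by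
    rintro x y ⟨m, hm, hm'⟩ ⟨n, hn, hn'⟩
    exact ⟨m + n, by simp [hm, hn, mul_add], by simp [hm', hn', mul_add]⟩
  smul_mem' := by
    rintro k x ⟨m, hm, hm'⟩
    exact ⟨k * m, by simp [hm, mul_left_comm], by simp [hm', mul_left_comm]⟩

/-- A complex line is closed under division by n. -/
theorem lineLattice_saturated (a a' : ℂ) (n : ℤ) (x : Λ × Λ') (hn : n ≠ 0)
    (hx : n • x ∈ lineLattice Λ Λ' a a') : x ∈ lineLattice Λ Λ' a a' := by
  obtain ⟨m, hm, hm'⟩ := hx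
  have hn' : (n : ℂ) ≠ 0 := Int.cast_ne_zero.2 hn
  simp only [Prod.smul_fst, Prod.smul_snd, Submodule.coe_smul, zsmul_eq_mul] at hm hm'
  refine ⟨m / n, ?_, ?_⟩
  · field_simp
    linear_combination hm
  · field_simp
    linear_combination hm'

/-- The map z ↦ (az, a'z) identifies the rank-two lattice `M` with the lattice points on the line.
-/
theorem finrank_lineLattice {M : Submodule ℤ ℂ} [DiscreteTopology M] [IsZLattice ℝ M] {a a' : ℂ}
    (hM : ∀ z, z ∈ M ↔ a * z ∈ Λ ∧ a' * z ∈ Λ') :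
    Module.finrank ℤ (lineLattice Λ Λ' a a') = 2 := by
  let f : M →ₗ[ℤ] Λ × Λ' :=
    { toFun := fun z => (⟨a * z, ((hM z).1 z.2).1⟩, ⟨a' * z, ((hM z).1 z.2).2⟩)
      map_add' := fun x y => Prod.ext (Subtype.ext (mul_add a (x : ℂ) y))
        (Subtype.ext (mul_add a' (x : ℂ) y))
      map_smul' := fun k x => Prod.ext (Subtype.ext (mul_smul_comm k a (x : ℂ)))
        (Subtype.ext (mul_smul_comm k a' (x : ℂ))) }
  -- Otherwise `M` would be all of ℂ, which is connected and not discrete.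
  have hne : ¬ (a = 0 ∧ a' = 0) := by
    rintro ⟨rfl, rfl⟩
    have hall : ∀ z, z ∈ M := fun z => (hM z).2 (by simp)
    have h01 := PreconnectedSpace.constant (inferInstance : PreconnectedSpace ℂ)
      (f := fun z => (⟨z, hall z⟩ : M)) (by fun_prop) (x := 0) (y := 1)
    exact zero_ne_one congr(($h01 : ℂ))
  have hf : Function.Injective f := by
    intro x y hxy
    have h1 : a * x = a * y := congr((($hxy).1 : ℂ))
    have h2 : a' * x = a' * y := congr((($hxy).2 : ℂ))
    ext
    by_cases ha : a = 0
    · exact mul_left_cancel₀ (fun ha' => hne ⟨ha, ha'⟩) h2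
    · exact mul_left_cancel₀ ha h1
  have hrange : LinearMap.range f = lineLattice Λ Λ' a a' := by
    ext x
    constructor
    · rintro ⟨z, rfl⟩
      exact ⟨z, rfl, rfl⟩
    · rintro ⟨z, hz, hz'⟩
      have hzM : z ∈ M := (hM z).2 ⟨hz ▸ x.1.2, hz' ▸ x.2.2⟩
      exact ⟨⟨z, hzM⟩, Prod.ext (Subtype.ext hz.symm) (Subtype.ext hz'.symm)⟩
  rw [← hrange, LinearMap.finrank_range_of_inj hf, ZLattice.rank ℝ, Complex.finrank_real_complex]

end lattice

end ComplexTorus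

end

/-! ### The main theorem -/

open ComplexTorus in
theorem mainTheorem4
    (Λ Λ' : Submodule ℤ ℂ) [DiscreteTopology Λ] [IsZLattice ℝ Λ]
    [DiscreteTopology Λ'] [IsZLattice ℝ Λ']
    (C : Fin 4 → Set (ComplexTorus Λ × ComplexTorus Λ'))
    (hC : ∀ j, IsTorusIn (𝓘(ℂ, ℂ).prod 𝓘(ℂ, ℂ)) (C j))
    (hCC : ∀ j k, j ≠ k → intersectionNumber (𝓘(ℂ, ℂ).prod 𝓘(ℂ, ℂ)) (C j) (C k) ≠ 0)
    (e : ℕ) (he : 1 < e) :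
    (∃ (A' : Type) (_ : TopologicalSpace A') (_ : ChartedSpace (ℂ × ℂ) A')
        (_ : IsManifold 𝓘(ℂ, ℂ × ℂ) ω A') (π : A' → ComplexTorus Λ × ComplexTorus Λ'),
      IsEtaleCover 𝓘(ℂ, ℂ × ℂ) (𝓘(ℂ, ℂ).prod 𝓘(ℂ, ℂ)) e π ∧
        ∀ j, IsConnected (π ⁻¹' C j)) ∧
    (∀ (A' : Type*) [TopologicalSpace A'] [ChartedSpace (ℂ × ℂ) A']
        [IsManifold 𝓘(ℂ, ℂ × ℂ) ω A'] (π : A' → ComplexTorus Λ × ComplexTorus Λ'),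
      IsEtaleCover 𝓘(ℂ, ℂ × ℂ) (𝓘(ℂ, ℂ).prod 𝓘(ℂ, ℂ)) e π →
        (∀ j, IsConnected (π ⁻¹' C j)) →
          ∀ j k, intersectionNumber 𝓘(ℂ, ℂ × ℂ) (π ⁻¹' C j) (π ⁻¹' C k) =
            e * intersectionNumber (𝓘(ℂ, ℂ).prod 𝓘(ℂ, ℂ)) (C j) (C k)) := by
  refine ⟨?_, fun A' _ _ _ π hπ _ j k => hπ.intersectionNumber_preimage (C j) (C k)⟩
  choose M hM hM' a a' c c' hCeq hMa using fun j => (hC j).exists_affine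
  have := ZLattice.module_free ℝ Λ
  have := ZLattice.module_free ℝ Λ'
  have := ZLattice.module_finite ℝ Λ
  have := ZLattice.module_finite ℝ Λ'
  have hrank : Module.finrank ℤ (Λ × Λ') = 4 := by
    rw [Module.finrank_prod, ZLattice.rank ℝ, ZLattice.rank ℝ, Complex.finrank_real_complex]
  obtain ⟨χ, hχ⟩ := Submodule.exists_functional_modEq_one hrank
    (fun j => lineLattice Λ Λ' (a j) (a' j)) (fun j => finrank_lineLattice (hMa j))
    (fun j => lineLattice_saturated (a j) (a' j)) e (by omega)
  refine ⟨ComplexTorus (sublattice Λ Λ' χ e), inferInstance, inferInstance, inferInstance,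
    toProd sublattice_le, ?_, fun j => ?_⟩
  -- The degree needs only some l with χ(l) ≡ 1 mod e; any of the four lines provides one.
  · obtain ⟨l, -, hl⟩ := hχ 0
    exact isEtaleCover_toProd (by omega) hl
  · obtain ⟨l, hla, hl⟩ := hχ j
    rw [hCeq j]
    exact isConnected_toProd_preimage (a j) (a' j) (c j) (c' j) hl hla
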